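/- Let $\alpha>0$ and let $dA$ be Lebesgue measure on $\mathbb{C}$. Let $F^\infty_\alpha$ be the space of entire functions $f$ with $\|f\|_{\infty,\alpha}=\sup_{z\in\mathbb{C}}|f(z)|e^{-\alpha|z|^2/2}<\infty$, normed by $\|\cdot\|_{\infty,\alpha}$. Write $K_z(\omega)=e^{\alpha\bar z\omega}$ and $d\lambda_\alpha(\omega)=\frac{\alpha}{\pi}e^{-\alpha|\omega|^2}\,dA(\omega)$. Let $\varphi:\mathbb{C}\to\mathbb{C}$ belong to $BMO$, that is, $\varphi$ is locally integrable and, for some $r>0$, $$\sup_{z\in\mathbb{C}}\frac{1}{|B(z,r)|}\int_{B(z,r)}|\varphi-\hat\varphi_r(z)|\,dA<\infty,\qquad \hat\varphi_r(z)=\frac{1}{|B(z,r)|}\int_{B(z,r)}\varphi\,dA .$$ Let $t>0$ and suppose that the $t$-Berezin transform of $|\varphi|$, $$\widetilde{|\varphi|}_t(z)=\frac{\alpha}{\pi}\int_{\mathbb{C}}|\varphi(\omega)|\,e^{-\frac{\alpha t}{2}|z-\omega|^2}\,dA(\omega),$$ belongs to $C_0(\mathbb{C})$, that is, it is continuous and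 tends to $0$ as $|z|\to\infty$ (for $t=2$ this is the Berezin transform of $|\varphi|$). Then the Toeplitz operator $$T_\varphi f(z)=\int_{\mathbb{C}}\varphi(\omega)f(\omega)\overline{K_z(\omega)}\,d\lambda_\alpha(\omega)$$ is well defined on $F^\infty_\alpha$ (the integral converges absolutely for all $f\in F^\infty_\alpha$ and $z\in\mathbb{C}$), maps $F^\infty_\alpha$ into itself, and is a compact linear operator on $F^\infty_\alpha$. -/

import Mathlib

open MeasureTheory Filter Topology

noncomputable section

namespace Fock

/-- The Gaussian probability measure `dλ_α(ω) = (α/π) e^{-α|ω|²} dA(ω)` on `ℂ`. -/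
def gaussian (α : ℝ) : Measure ℂ :=
  (volume : Measure ℂ).withDensity
    fun ω => ENNReal.ofReal (α / Real.pi * Real.exp (-α * ‖ω‖ ^ 2))

/-- The reproducing kernel `K_z(ω) = e^{α z̄ ω}` of the Fock space `F²_α`. -/
def kernel (α : ℝ) (z ω : ℂ) : ℂ :=
  Complex.exp (α * (starRingEnd ℂ) z * ω)

/-- The modulus of `f` against the Gaussian weight, `|f(z)| e^{-α|z|²/2}`. -/
def weighted (α : ℝ) (f : ℂ → ℂ) (z : ℂ) : ℝ :=
  ‖f z‖ * Real.exp (-(α / 2) * ‖z‖ ^ 2)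

lemma weighted_nonneg (α : ℝ) (f : ℂ → ℂ) (z : ℂ) : 0 ≤ weighted α f z := by
  unfold weighted; positivity

lemma weighted_add_le (α : ℝ) (f g : ℂ → ℂ) (z : ℂ) :
    weighted α (f + g) z ≤ weighted α f z + weighted α g z := by
  unfold weighted
  rw [← add_mul]
  exact mul_le_mul_of_nonneg_right (norm_add_le _ _) (Real.exp_pos _).le

lemma weighted_smul (α : ℝ) (c : ℂ) (f : ℂ → ℂ) (z : ℂ) :
    weighted α (c • f) z = ‖c‖ * weighted α f z := by
  simp [weighted, mul_assoc]

/-- The entire functions `f` with `sup_z |f(z)| e^{-α|z|²/2} < ∞`, as a linear space. -/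
def entireBounded (α : ℝ) : Submodule ℂ (ℂ → ℂ) where
  carrier := {f | Differentiable ℂ f ∧ BddAbove (Set.range (weighted α f))}
  zero_mem' := by
    refine ⟨differentiable_const 0, 0, ?_⟩
    rintro _ ⟨z, rfl⟩
    simp [weighted]
  add_mem' := by
    rintro f g ⟨hf, A, hA⟩ ⟨hg, B, hB⟩
    refine ⟨hf.add hg, A + B, ?_⟩
    rintro _ ⟨z, rfl⟩
    exact (weighted_add_le α f g z).trans (add_le_add (hA ⟨z, rfl⟩) (hB ⟨z, rfl⟩))
  smul_mem' := by
    rintro c f ⟨hf, A, hA⟩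
    refine ⟨hf.const_smul c, ‖c‖ * A, ?_⟩
    rintro _ ⟨z, rfl⟩
    rw [weighted_smul]
    exact mul_le_mul_of_nonneg_left (hA ⟨z, rfl⟩) (norm_nonneg c)

/-- The Fock space `F^∞_α`. It is a separate type, so that its topology is the one of the norm
below and not the topology of pointwise convergence inherited from `ℂ → ℂ`. -/
def FInfty (α : ℝ) : Type := entireBounded α

instance (α : ℝ) : AddCommGroup (FInfty α) := inferInstanceAs (AddCommGroup (entireBounded α))

instance (α : ℝ) : Module ℂ (FInfty α) := inferInstanceAs (Module ℂ (entireBounded α))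

instance (α : ℝ) : CoeFun (FInfty α) (fun _ => ℂ → ℂ) := ⟨fun f => f.1⟩

/-- The norm `‖f‖_{∞,α} = sup_z |f(z)| e^{-α|z|²/2}`. -/
instance (α : ℝ) : Norm (FInfty α) := ⟨fun f => ⨆ z : ℂ, weighted α f z⟩

lemma FInfty.norm_def {α : ℝ} (f : FInfty α) : ‖f‖ = ⨆ z : ℂ, weighted α f z := rfl

lemma FInfty.weighted_le_norm {α : ℝ} (f : FInfty α) (z : ℂ) : weighted α f z ≤ ‖f‖ :=
  le_ciSup f.2.2 z

lemma FInfty.normCore (α : ℝ) : NormedSpace.Core ℂ (FInfty α) where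
  norm_nonneg f := Real.iSup_nonneg fun z => weighted_nonneg α f z
  norm_smul c f := by
    rw [norm_def, norm_def, Real.mul_iSup_of_nonneg (norm_nonneg c)]
    exact congrArg iSup (funext fun z => weighted_smul α c f z)
  norm_triangle f g :=
    ciSup_le fun z => (weighted_add_le α f g z).trans
      (add_le_add (weighted_le_norm f z) (weighted_le_norm g z))
  norm_eq_zero_iff f := by
    constructor
    · intro h
      refine Subtype.ext (funext fun z => ?_)
      have h1 : weighted α f z ≤ 0 := h ▸ weighted_le_norm f z
      have h2 : ‖f z‖ ≤ 0 := nonpos_of_mul_nonpos_left h1 (Real.exp_pos _)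
      exact norm_le_zero_iff.1 h2
    · rintro rfl
      have h0 : ∀ z : ℂ, weighted α (0 : FInfty α) z = 0 := fun z => by
        change ‖(0 : ℂ)‖ * _ = 0
        simp
      rw [norm_def]
      simp only [h0, ciSup_const]

instance (α : ℝ) : NormedAddCommGroup (FInfty α) :=
  NormedAddCommGroup.ofCore (FInfty.normCore α)

instance (α : ℝ) : NormedSpace ℂ (FInfty α) :=
  NormedSpace.ofCore (FInfty.normCore α)

/-- `BMO`: the locally integrable functions whose mean oscillation over the discs of some fixed
radius `r` is bounded, `sup_z |B(z,r)|⁻¹ ∫_{B(z,r)} |φ - φ̂_r(z)| dA < ∞`, where `φ̂_r(z)` is the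
average of `φ` over `B(z,r)`. -/
def MemBMO (φ : ℂ → ℂ) : Prop :=
  LocallyIntegrable φ volume ∧
    ∃ r : ℝ, 0 < r ∧ ∃ C : ℝ, ∀ z : ℂ,
      ⨍ ω in Metric.ball z r, ‖φ ω - ⨍ u in Metric.ball z r, φ u‖ ≤ C

/-- The `t`-Berezin transform `(α/π) ∫ g(ω) e^{-αt|z-ω|²/2} dA(ω)` of a real function `g`. -/
def berezin (α t : ℝ) (g : ℂ → ℝ) (z : ℂ) : ℝ :=
  α / Real.pi * ∫ ω : ℂ, g ω * Real.exp (-(α * t / 2) * ‖z - ω‖ ^ 2)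

/-- `g ∈ C₀(ℂ)`: `g` is continuous and vanishes at infinity. -/
def MemC0 (g : ℂ → ℝ) : Prop :=
  Continuous g ∧ Tendsto g (cocompact ℂ) (𝓝 0)

/-- The integrand `φ(ω) f(ω) \overline{K_z(ω)}` of the Toeplitz operator. -/
def toeplitzIntegrand (α : ℝ) (φ f : ℂ → ℂ) (z ω : ℂ) : ℂ :=
  φ ω * f ω * (starRingEnd ℂ) (kernel α z ω)

/-- `T` is the Toeplitz operator `T_φ` on `F^∞_α`: for every `f ∈ F^∞_α` and every `z`, the integral
`∫ φ(ω) f(ω) \overline{K_z(ω)} dλ_α(ω)` converges absolutely and is the value of `T f` at `z`. -/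
def IsToeplitz (α : ℝ) (φ : ℂ → ℂ) (T : FInfty α → FInfty α) : Prop :=
  ∀ (f : FInfty α) (z : ℂ),
    Integrable (toeplitzIntegrand α φ f z) (gaussian α) ∧
      T f z = ∫ ω, toeplitzIntegrand α φ f z ω ∂(gaussian α)

end Fock

end

noncomputable section

namespace Fock

/-! Since `2 Re(z̄ω) = |z|² + |ω|² - |z-ω|²`, the weights and the kernel combine into
`e^{-α|z-ω|²/2}`, so that `|T_φ f(z)| e^{-α|z|²/2} ≤ ‖f‖ b(z)`, where `b` is the 1-Berezin transform
of `|φ|` (`weighted_toeplitz_le`). The unit ball is thus mapped into the entire functions dominated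
by the single function `b`. If `b` is bounded and vanishes at infinity, these form a compact set:
Montel's theorem handles bounded regions, and the decay of `b` makes the tails uniformly small
(`isCompact_setOf_weighted_le`).

The passage from `t` to 1 rests on `|φ| ≥ 0`: convolving the `t`-Berezin transform with a wide
enough Gaussian dominates a multiple of `b`, and convolution with a Gaussian preserves boundedness
and decay (`MemBMO.berezin_one_of_memC0`).

The oscillation bound serves only for absolute convergence: disc integrals of `|φ|` grow at most
linearly, so every Gaussian integrates `|φ|`. Bochner integrals of non-integrable functions are 0,
so decay of the transform alone would not give this. -/

/-! ### Gaussian integrals -/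

lemma integrable_exp_neg_mul_norm_sq {c : ℝ} (hc : 0 < c) :
    Integrable fun ω : ℂ => Real.exp (-c * ‖ω‖ ^ 2) := by
  have h := (GaussianFourier.integrable_cexp_neg_mul_sq_norm_add (V := ℂ) (b := (c : ℂ))
    (by simpa using hc) 0 0).norm
  refine h.congr (ae_of_all _ fun ω => ?_)
  simp only [zero_mul, add_zero, Complex.norm_exp]
  norm_cast

lemma integrable_exp_neg_mul_norm_sub_sq {c : ℝ} (hc : 0 < c) (z : ℂ) :
    Integrable fun ω : ℂ => Real.exp (-c * ‖z - ω‖ ^ 2) :=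
  (integrable_exp_neg_mul_norm_sq hc).comp_sub_left z

/-- A Gaussian absorbs exponentials of linear functions. -/
lemma linear_sub_sq_le {c : ℝ} (hc : 0 < c) (k x : ℝ) :
    k * x - c * x ^ 2 ≤ k ^ 2 / (2 * c) - c / 2 * x ^ 2 := by
  have h : k ^ 2 / (2 * c) - c / 2 * x ^ 2 - (k * x - c * x ^ 2) = (k - c * x) ^ 2 / (2 * c) := by
    field_simp
    ring
  have : 0 ≤ (k - c * x) ^ 2 / (2 * c) := by positivity
  linarith

/-- By `x + 1 ≤ e^x` linear growth is at most exponential, and half of the Gaussian absorbs it. -/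
lemma integrable_norm_add_mul_exp {c : ℝ} (hc : 0 < c) (A B : ℝ) (z : ℂ) :
    Integrable fun u : ℂ => (A + B * ‖u‖) * Real.exp (-c * ‖z - u‖ ^ 2) := by
  have h := (integrable_exp_neg_mul_norm_sub_sq (half_pos hc) z).const_mul
    ((|A| + |B| * (‖z‖ + 1)) * Real.exp (1 / (2 * c)))
  refine h.mono' (by fun_prop) (ae_of_all _ fun u => ?_)
  rw [norm_mul, Real.norm_eq_abs, Real.norm_eq_abs, Real.abs_exp]
  set x := ‖z - u‖
  have hx : 0 ≤ x := norm_nonneg _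
  have hu : ‖u‖ ≤ ‖z‖ + x := by
    have := norm_sub_le z (z - u)
    simpa using this
  have hz := norm_nonneg z
  have h1 : |A + B * ‖u‖| ≤ (|A| + |B| * (‖z‖ + 1)) * Real.exp x := by
    have he : x + 1 ≤ Real.exp x := Real.add_one_le_exp x
    calc |A + B * ‖u‖| ≤ |A| + |B| * ‖u‖ := by
          refine (abs_add_le _ _).trans ?_
          rw [abs_mul, abs_norm]
      _ ≤ |A| + |B| * (‖z‖ + x) := by gcongr
      _ ≤ (|A| + |B| * (‖z‖ + 1)) * (x + 1) := by
          nlinarith [mul_nonneg (abs_nonneg A) hx, mul_nonneg (mul_nonneg (abs_nonneg B) hz) hx,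
            abs_nonneg B, mul_nonneg (abs_nonneg B) hx]
      _ ≤ _ := by gcongr
  calc |A + B * ‖u‖| * Real.exp (-c * x ^ 2)
      ≤ (|A| + |B| * (‖z‖ + 1)) * Real.exp x * Real.exp (-c * x ^ 2) := by gcongr
    _ = (|A| + |B| * (‖z‖ + 1)) * Real.exp (1 * x - c * x ^ 2) := by
        rw [mul_assoc, ← Real.exp_add]; ring_nf
    _ ≤ (|A| + |B| * (‖z‖ + 1)) * Real.exp (1 ^ 2 / (2 * c) - c / 2 * x ^ 2) := by
        gcongr ?_ * Real.exp ?_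
        exact linear_sub_sq_le hc 1 x
    _ = _ := by
        rw [mul_assoc, ← Real.exp_add]; ring_nf

/-! ### Growth and Gaussian integrability of BMO functions -/

/-- Both discs contain the disc of radius `r / 2` about the midpoint, on which `φ` is close in mean
to both averages. Its area is a quarter of theirs, and two oscillations are added: hence `8 = 4 *
2`. -/
lemma norm_setAverage_sub_le {φ : ℂ → ℂ} (hφ : LocallyIntegrable φ volume) {r C : ℝ}
    (hr : 0 < r) (hC : ∀ z : ℂ,
      ⨍ ω in Metric.ball z r, ‖φ ω - ⨍ u in Metric.ball z r, φ u‖ ≤ C)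
    {z w : ℂ} (h : dist z w ≤ r) :
    ‖(⨍ u in Metric.ball z r, φ u) - ⨍ u in Metric.ball w r, φ u‖ ≤ 8 * C := by
  set a := ⨍ u in Metric.ball z r, φ u
  set b := ⨍ u in Metric.ball w r, φ u
  set p : ℂ := midpoint ℝ z w
  have hpz : dist p z ≤ r / 2 := by
    rw [dist_midpoint_left]; simp; linarith
  have hpw : dist p w ≤ r / 2 := by
    rw [dist_midpoint_right]; simp; linarith
  have hsz : Metric.ball p (r / 2) ⊆ Metric.ball z r := Metric.ball_subset_ball' (by linarith)
  have hsw : Metric.ball p (r / 2) ⊆ Metric.ball w r := Metric.ball_subset_ball' (by linarith)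
  have hi : ∀ (x c : ℂ), IntegrableOn (fun ω => ‖φ ω - c‖) (Metric.ball x r) := fun x c => by
    have h1 : IntegrableOn φ (Metric.ball x r) :=
      (hφ.integrableOn_isCompact (isCompact_closedBall x r)).mono_set Metric.ball_subset_closedBall
    exact (h1.sub (integrableOn_const (by finiteness))).norm
  have hvol : ∀ (x : ℂ) (s : ℝ), 0 ≤ s → volume.real (Metric.ball x s) = Real.pi * s ^ 2 := by
    intro x s hs
    rw [Measure.real, Complex.volume_ball]
    simp [hs, mul_comm]
  have hosc : ∀ x : ℂ, ∫ ω in Metric.ball x r, ‖φ ω - ⨍ u in Metric.ball x r, φ u‖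
      ≤ Real.pi * r ^ 2 * C := by
    intro x
    have := hC x
    rw [setAverage_eq, hvol x r hr.le, smul_eq_mul] at this
    rwa [inv_mul_le_iff₀ (by positivity)] at this
  have key : Real.pi * (r / 2) ^ 2 * ‖a - b‖ ≤ 2 * (Real.pi * r ^ 2 * C) := by
    calc Real.pi * (r / 2) ^ 2 * ‖a - b‖ = ∫ ω in Metric.ball p (r / 2), ‖a - b‖ := by
          rw [setIntegral_const, hvol p (r / 2) (by positivity), smul_eq_mul]
      _ ≤ ∫ ω in Metric.ball p (r / 2), (‖φ ω - a‖ + ‖φ ω - b‖) := by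
          refine integral_mono (integrableOn_const (by finiteness))
            (((hi z a).mono_set hsz).add ((hi w b).mono_set hsw)) fun ω => ?_
          have : a - b = (φ ω - b) - (φ ω - a) := by ring
          simp only [this]
          exact (norm_sub_le _ _).trans (add_comm _ _).le
      _ = (∫ ω in Metric.ball p (r / 2), ‖φ ω - a‖) + ∫ ω in Metric.ball p (r / 2), ‖φ ω - b‖ :=
          integral_add ((hi z a).mono_set hsz) ((hi w b).mono_set hsw)
      _ ≤ (∫ ω in Metric.ball z r, ‖φ ω - a‖) + ∫ ω in Metric.ball w r, ‖φ ω - b‖ := by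
          refine add_le_add (setIntegral_mono_set (hi z a) (ae_of_all _ fun _ => norm_nonneg _)
            hsz.eventuallyLE) (setIntegral_mono_set (hi w b) (ae_of_all _ fun _ => norm_nonneg _)
            hsw.eventuallyLE)
      _ ≤ 2 * (Real.pi * r ^ 2 * C) := by
          have := hosc z
          have := hosc w
          linarith
  have hpos : 0 < Real.pi * r ^ 2 := by positivity
  have : Real.pi * r ^ 2 * ‖a - b‖ ≤ Real.pi * r ^ 2 * (8 * C) := by nlinarith
  exact le_of_mul_le_mul_left this hpos

/-- The averages of a `BMO` function grow at most linearly. -/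
lemma norm_setAverage_ball_le {φ : ℂ → ℂ} (hφ : LocallyIntegrable φ volume) {r C : ℝ}
    (hr : 0 < r) (hC : ∀ z : ℂ,
      ⨍ ω in Metric.ball z r, ‖φ ω - ⨍ u in Metric.ball z r, φ u‖ ≤ C) (n : ℕ) :
    ∀ z : ℂ, ‖z‖ ≤ n * r →
      ‖⨍ u in Metric.ball z r, φ u‖ ≤ ‖⨍ u in Metric.ball (0 : ℂ) r, φ u‖ + 8 * C * n := by
  induction n with
  | zero =>
    intro z hz
    have : z = 0 := by simpa using hz
    simp [this]
  | succ n ih =>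
    intro z hz
    -- Moving `z` towards 0 by the fraction `1 / (n + 1)` costs at most `r` and lands in the disc of
    -- radius `n * r`.
    set s : ℝ := n / (n + 1)
    have hn : (0 : ℝ) < n + 1 := by positivity
    push_cast at hz
    have h1 : ‖s • z‖ ≤ n * r := by
      rw [norm_smul, Real.norm_of_nonneg (by positivity)]
      calc s * ‖z‖ ≤ s * ((n + 1) * r) := by gcongr
        _ = n * r := by simp only [s]; field_simp
    have h2 : dist z (s • z) ≤ r := by
      have : z - s • z = (1 / (n + 1 : ℝ)) • z := by
        have h : 1 / (n + 1 : ℝ) = 1 - s := by simp only [s]; field_simp; ring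
        rw [h, sub_smul, one_smul]
      rw [dist_eq_norm, this, norm_smul, Real.norm_of_nonneg (by positivity), one_div,
        inv_mul_le_iff₀ hn]
      exact hz
    have h3 := norm_setAverage_sub_le hφ hr hC h2
    have h4 := norm_le_insert' (⨍ u in Metric.ball z r, φ u) (⨍ u in Metric.ball (s • z) r, φ u)
    have h5 := ih _ h1
    push_cast
    linarith

/-- Splitting off the average over the disc leaves the bounded oscillation; the average itself is
reached from the origin in `⌈‖z‖ / r⌉₊` steps. -/
lemma MemBMO.exists_setIntegral_norm_le {φ : ℂ → ℂ} (hφ : MemBMO φ) :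
    ∃ r : ℝ, 0 < r ∧ ∃ A B : ℝ, 0 ≤ A ∧ 0 ≤ B ∧
      ∀ z : ℂ, ∫ ω in Metric.ball z r, ‖φ ω‖ ≤ A + B * ‖z‖ := by
  obtain ⟨hloc, r, hr, C, hC⟩ := hφ
  have hC0 : 0 ≤ C := le_trans (by rw [setAverage_eq]; positivity) (hC 0)
  set M := ‖⨍ u in Metric.ball (0 : ℂ) r, φ u‖
  refine ⟨r, hr, Real.pi * r ^ 2 * (C + M + 8 * C), Real.pi * r ^ 2 * (8 * C / r), by positivity,
    by positivity, fun z => ?_⟩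
  have hvol : volume.real (Metric.ball z r) = Real.pi * r ^ 2 := by
    rw [Measure.real, Complex.volume_ball]
    simp [hr.le, mul_comm]
  have hint : IntegrableOn φ (Metric.ball z r) :=
    (hloc.integrableOn_isCompact (isCompact_closedBall z r)).mono_set Metric.ball_subset_closedBall
  set a := ⨍ u in Metric.ball z r, φ u
  have ha : ‖a‖ ≤ M + 8 * C * (‖z‖ / r + 1) := by
    refine (norm_setAverage_ball_le hloc hr hC ⌈‖z‖ / r⌉₊ z ?_).trans ?_
    · rw [← div_le_iff₀ hr]; exact Nat.le_ceil _
    · gcongr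
      exact (Nat.ceil_lt_add_one (by positivity)).le
  have h1 : ∫ ω in Metric.ball z r, ‖φ ω - a‖ ≤ Real.pi * r ^ 2 * C := by
    have := hC z
    rw [setAverage_eq, hvol, smul_eq_mul] at this
    rwa [inv_mul_le_iff₀ (by positivity)] at this
  have hc : IntegrableOn (fun _ : ℂ => a) (Metric.ball z r) := integrableOn_const (by finiteness)
  calc ∫ ω in Metric.ball z r, ‖φ ω‖ ≤ ∫ ω in Metric.ball z r, (‖φ ω - a‖ + ‖a‖) := by
        refine integral_mono hint.norm ((hint.sub hc).norm.add hc.norm) fun ω => ?_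
        have := norm_add_le (φ ω - a) a
        simpa using this
    _ = (∫ ω in Metric.ball z r, ‖φ ω - a‖) + Real.pi * r ^ 2 * ‖a‖ := by
        rw [integral_add (f := fun ω => ‖φ ω - a‖) (hint.sub hc).norm hc.norm, setIntegral_const,
          hvol, smul_eq_mul]
    _ ≤ Real.pi * r ^ 2 * C + Real.pi * r ^ 2 * (M + 8 * C * (‖z‖ / r + 1)) := by gcongr
    _ = _ := by ring

lemma norm_sub_sq_le (z u ω : ℂ) : ‖z - u‖ ^ 2 ≤ 2 * ‖z - ω‖ ^ 2 + 2 * ‖u - ω‖ ^ 2 := by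
  have h : ‖z - u‖ ≤ ‖z - ω‖ + ‖u - ω‖ := by
    have := norm_sub_le (z - ω) (u - ω)
    simpa using this
  nlinarith [norm_nonneg (z - u), sq_nonneg (‖z - ω‖ - ‖u - ω‖)]

/-- A `BMO` function is integrable against every Gaussian. -/
lemma MemBMO.integrable_mul_exp {φ : ℂ → ℂ} (hφ : MemBMO φ) {c : ℝ} (hc : 0 < c) (z : ℂ) :
    Integrable fun ω => ‖φ ω‖ * Real.exp (-c * ‖z - ω‖ ^ 2) := by
  obtain ⟨r, hr, A, B, hA, hB, hAB⟩ := hφ.exists_setIntegral_norm_le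
  have hm : AEStronglyMeasurable φ volume := hφ.1.aestronglyMeasurable
  have hint : ∀ u, IntegrableOn φ (Metric.ball u r) := fun u =>
    (hφ.1.integrableOn_isCompact (isCompact_closedBall u r)).mono_set Metric.ball_subset_closedBall
  refine ⟨hm.norm.mul (by fun_prop), ?_⟩
  set g : ℂ → ENNReal := fun ω => ‖‖φ ω‖ * Real.exp (-c * ‖z - ω‖ ^ 2)‖ₑ
  have hg : AEMeasurable g := (hm.norm.mul (by fun_prop)).enorm
  set V : ENNReal := volume (Metric.ball (0 : ℂ) r)
  have hV0 : V ≠ 0 := (Metric.measure_ball_pos volume 0 hr).ne'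
  have hV : ∀ u : ℂ, volume (Metric.ball u r) = V := fun u => by
    simp only [V, Complex.volume_ball]
  have hVt : V ≠ ⊤ := by simp only [V]; finiteness
  set S : Set (ℂ × ℂ) := {p | dist p.1 p.2 < r}
  have hS : MeasurableSet S := (isOpen_lt (by fun_prop) (by fun_prop)).measurableSet
  -- Tonelli for `G` gives `V * ∫ g = ∫_u ∫_{B(u,r)} g`. On `B(u,r)` the Gaussian is at most `e^{c
  -- r²} e^{-(c/2)|z-u|²}`, so the disc bound applies.
  set G : ℂ → ℂ → ENNReal := fun ω u => S.indicator (fun p => g p.1) (ω, u)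
  have hG : AEMeasurable (Function.uncurry G) (volume.prod volume) :=
    (hg.comp_fst).indicator hS
  have e1 : ∀ ω, ∫⁻ u, G ω u = V * g ω := by
    intro ω
    have : G ω = (Metric.ball ω r).indicator fun _ => g ω := by
      ext u
      simp [G, S, Set.indicator, Metric.mem_ball, dist_comm]
    rw [this, lintegral_indicator Metric.isOpen_ball.measurableSet, setLIntegral_const, hV,
      mul_comm]
  have e2 : ∀ u, ∫⁻ ω, G ω u ≤
      ENNReal.ofReal (Real.exp (c * r ^ 2) * ((A + B * ‖u‖) * Real.exp (-(c / 2) * ‖z - u‖ ^ 2))) := by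
    intro u
    have : (fun ω => G ω u) = (Metric.ball u r).indicator g := by
      ext ω
      simp [G, S, Set.indicator, Metric.mem_ball]
    rw [this, lintegral_indicator Metric.isOpen_ball.measurableSet]
    calc ∫⁻ ω in Metric.ball u r, g ω
        ≤ ∫⁻ ω in Metric.ball u r, ENNReal.ofReal
            (‖φ ω‖ * (Real.exp (c * r ^ 2) * Real.exp (-(c / 2) * ‖z - u‖ ^ 2))) := by
          refine setLIntegral_mono' Metric.isOpen_ball.measurableSet fun ω hω => ?_
          simp only [g]
          rw [Real.enorm_of_nonneg (by positivity)]
          refine ENNReal.ofReal_le_ofReal ?_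
          rw [← Real.exp_add]
          gcongr ?_ * Real.exp ?_
          have h1 := norm_sub_sq_le z u ω
          have h2 : ‖u - ω‖ ≤ r := by
            rw [← dist_eq_norm, dist_comm]; exact (Metric.mem_ball.1 hω).le
          have h3 : ‖u - ω‖ ^ 2 ≤ r ^ 2 := by gcongr
          nlinarith
      _ = ENNReal.ofReal ((∫ ω in Metric.ball u r, ‖φ ω‖) *
            (Real.exp (c * r ^ 2) * Real.exp (-(c / 2) * ‖z - u‖ ^ 2))) := by
          rw [← integral_mul_const, ofReal_integral_eq_lintegral_ofReal]
          · exact (hint u).norm.mul_const _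
          · exact ae_of_all _ fun ω => by positivity
      _ ≤ _ := by
          refine ENNReal.ofReal_le_ofReal ?_
          calc _ ≤ (A + B * ‖u‖) * (Real.exp (c * r ^ 2) * Real.exp (-(c / 2) * ‖z - u‖ ^ 2)) := by
                gcongr
                exact hAB u
            _ = _ := by ring
  have e3 : V * ∫⁻ ω, g ω < ⊤ := by
    calc V * ∫⁻ ω, g ω = ∫⁻ ω, ∫⁻ u, G ω u := by
          rw [← lintegral_const_mul' _ _ hVt]
          simp only [e1]
      _ = ∫⁻ u, ∫⁻ ω, G ω u := lintegral_lintegral_swap hG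
      _ ≤ ∫⁻ u, ENNReal.ofReal
            (Real.exp (c * r ^ 2) * ((A + B * ‖u‖) * Real.exp (-(c / 2) * ‖z - u‖ ^ 2))) :=
          lintegral_mono e2
      _ < ⊤ :=
          ((integrable_norm_add_mul_exp (half_pos hc) A B z).const_mul _).lintegral_lt_top
  exact (ENNReal.lt_top_of_mul_ne_top_right e3.ne hV0)

/-! ### Changing the parameter of the Berezin transform -/

lemma MemC0.exists_norm_le {g : ℂ → ℝ} (hg : MemC0 g) : ∃ M, ∀ z, ‖g z‖ ≤ M := by
  let G : ZeroAtInftyContinuousMap ℂ ℝ := ⟨⟨g, hg.1⟩, hg.2⟩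
  exact ⟨‖G.toBCF‖, fun z => G.toBCF.norm_coe_le_norm z⟩

/-- The convolution of a `C₀` function with a Gaussian vanishes at infinity. -/
lemma MemC0.tendsto_integral_mul_exp {g : ℂ → ℝ} (hg : MemC0 g) {c : ℝ} (hc : 0 < c) :
    Tendsto (fun z => ∫ u, g u * Real.exp (-c * ‖z - u‖ ^ 2)) (cocompact ℂ) (𝓝 0) := by
  obtain ⟨M, hM⟩ := hg.exists_norm_le
  have h1 : (fun z => ∫ u, g u * Real.exp (-c * ‖z - u‖ ^ 2)) =
      fun z => ∫ v, g (z - v) * Real.exp (-c * ‖v‖ ^ 2) := by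
    ext z
    rw [← integral_sub_left_eq_self _ volume z]
    simp
  -- Dominated convergence along a filter requires countable generation.
  have : (cocompact ℂ).IsCountablyGenerated := by
    rw [← Metric.cobounded_eq_cocompact, ← comap_norm_atTop]
    infer_instance
  rw [h1, ← integral_zero ℂ ℝ]
  refine tendsto_integral_filter_of_dominated_convergence
    (fun v => M * Real.exp (-c * ‖v‖ ^ 2)) ?_ ?_ ?_ ?_
  · refine Eventually.of_forall fun z => ?_
    have := hg.1
    exact Continuous.aestronglyMeasurable (by fun_prop)
  · refine Eventually.of_forall fun z => ae_of_all _ fun v => ?_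
    rw [norm_mul, Real.norm_eq_abs (Real.exp _), Real.abs_exp]
    gcongr
    exact hM _
  · exact (integrable_exp_neg_mul_norm_sq hc).const_mul M
  · refine ae_of_all _ fun v => ?_
    have h2 : Tendsto (fun z : ℂ => z - v) (cocompact ℂ) (cocompact ℂ) :=
      (Homeomorph.subRight v).isClosedEmbedding.tendsto_cocompact
    simpa only [zero_mul, Function.comp_apply] using (hg.2.comp h2).mul_const (Real.exp (-c * ‖v‖ ^ 2))

/-- Averaging a Gaussian integral against a second Gaussian controls the wider Gaussian integral. -/
lemma exists_integral_mul_exp_le {h : ℂ → ℝ} (h0 : ∀ ω, 0 ≤ h ω) (hm : AEStronglyMeasurable h volume)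
    {a c : ℝ} (ha : 0 < a) (hc : 0 < c)
    (hint : ∀ u, Integrable fun ω => h ω * Real.exp (-a * ‖u - ω‖ ^ 2))
    (hint' : ∀ z, Integrable fun u =>
      (∫ ω, h ω * Real.exp (-a * ‖u - ω‖ ^ 2)) * Real.exp (-c * ‖z - u‖ ^ 2)) :
    ∃ κ : ℝ, 0 < κ ∧ ∀ z, κ * ∫ ω, h ω * Real.exp (-(2 * c) * ‖z - ω‖ ^ 2) ≤
      ∫ u, (∫ ω, h ω * Real.exp (-a * ‖u - ω‖ ^ 2)) * Real.exp (-c * ‖z - u‖ ^ 2) := by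
  have hG := integrable_exp_neg_mul_norm_sq (show 0 < a + 2 * c by positivity)
  -- By `norm_sub_sq_le`, `a|u-ω|² + c|z-u|² ≤ (a + 2c)|u-ω|² + 2c|z-ω|²`; integrating the first
  -- term's Gaussian in `u` gives `κ`.
  set κ := ∫ v : ℂ, Real.exp (-(a + 2 * c) * ‖v‖ ^ 2)
  have hκ : 0 < κ := integral_exp_pos hG
  refine ⟨κ, hκ, fun z => ?_⟩
  have hR : 0 ≤ ∫ u, (∫ ω, h ω * Real.exp (-a * ‖u - ω‖ ^ 2)) * Real.exp (-c * ‖z - u‖ ^ 2) :=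
    integral_nonneg fun u => mul_nonneg
      (integral_nonneg fun ω => mul_nonneg (h0 ω) (Real.exp_pos _).le) (Real.exp_pos _).le
  rw [← integral_const_mul]
  rw [integral_eq_lintegral_of_nonneg_ae
    (ae_of_all _ fun ω => mul_nonneg hκ.le (mul_nonneg (h0 ω) (Real.exp_pos _).le))
    ((hm.mul (by fun_prop)).const_mul κ)]
  refine ENNReal.toReal_le_of_le_ofReal hR ?_
  set H : ℂ → ℂ → ENNReal := fun ω u =>
    ENNReal.ofReal (h ω * Real.exp (-a * ‖u - ω‖ ^ 2) * Real.exp (-c * ‖z - u‖ ^ 2))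
  have hH : AEMeasurable (Function.uncurry H) (volume.prod volume) := by
    have h1 : AEMeasurable (fun p : ℂ × ℂ => h p.1) (volume.prod volume) :=
      hm.aemeasurable.comp_fst
    refine ((h1.mul (g := fun p : ℂ × ℂ => Real.exp (-a * ‖p.2 - p.1‖ ^ 2)) ?_).mul
      (g := fun p : ℂ × ℂ => Real.exp (-c * ‖z - p.2‖ ^ 2)) ?_).ennreal_ofReal
    · exact Continuous.aemeasurable (by fun_prop)
    · exact Continuous.aemeasurable (by fun_prop)
  calc ∫⁻ ω, ENNReal.ofReal (κ * (h ω * Real.exp (-(2 * c) * ‖z - ω‖ ^ 2)))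
      ≤ ∫⁻ ω, ∫⁻ u, H ω u := by
        refine lintegral_mono fun ω => ?_
        have e1 : κ = ∫ u : ℂ, Real.exp (-(a + 2 * c) * ‖ω - u‖ ^ 2) :=
          (integral_sub_left_eq_self (fun v : ℂ => Real.exp (-(a + 2 * c) * ‖v‖ ^ 2))
            volume ω).symm
        rw [e1, ← integral_mul_const, ofReal_integral_eq_lintegral_ofReal
          ((hG.comp_sub_left ω).mul_const _)
          (ae_of_all _ fun u => mul_nonneg (Real.exp_pos _).le
            (mul_nonneg (h0 ω) (Real.exp_pos _).le))]
        refine lintegral_mono fun u => ENNReal.ofReal_le_ofReal ?_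
        rw [mul_left_comm, mul_assoc, ← Real.exp_add, ← Real.exp_add]
        refine mul_le_mul_of_nonneg_left (Real.exp_le_exp.2 ?_) (h0 ω)
        have := norm_sub_sq_le z u ω
        rw [norm_sub_rev ω u]
        nlinarith
    _ = ∫⁻ u, ∫⁻ ω, H ω u := lintegral_lintegral_swap hH
    _ = ∫⁻ u, ENNReal.ofReal
          ((∫ ω, h ω * Real.exp (-a * ‖u - ω‖ ^ 2)) * Real.exp (-c * ‖z - u‖ ^ 2)) := by
        refine lintegral_congr fun u => ?_
        rw [← integral_mul_const, ofReal_integral_eq_lintegral_ofReal ((hint u).mul_const _)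
          (ae_of_all _ fun ω => by have := h0 ω; positivity)]
    _ = _ := by
        rw [ofReal_integral_eq_lintegral_ofReal (hint' z)]
        exact ae_of_all _ fun u => mul_nonneg
          (integral_nonneg fun ω => mul_nonneg (h0 ω) (Real.exp_pos _).le) (Real.exp_pos _).le

/-- If some `t`-Berezin transform of `|φ|` is in `C₀`, then the `1`-Berezin transform is bounded and
vanishes at infinity. -/
lemma MemBMO.berezin_one_of_memC0 {α t : ℝ} (hα : 0 < α) (ht : 0 < t) {φ : ℂ → ℂ}
    (hφ : MemBMO φ) (h0 : MemC0 (berezin α t fun ω => ‖φ ω‖)) :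
    (∃ M, ∀ z, berezin α 1 (fun ω => ‖φ ω‖) z ≤ M) ∧
      Tendsto (berezin α 1 fun ω => ‖φ ω‖) (cocompact ℂ) (𝓝 0) := by
  set β := berezin α t fun ω => ‖φ ω‖
  have hβ : ∀ u, β u = α / Real.pi * ∫ ω, ‖φ ω‖ * Real.exp (-(α * t / 2) * ‖u - ω‖ ^ 2) :=
    fun u => rfl
  have hαπ : 0 < α / Real.pi := by positivity
  have hβ' : ∀ u, ∫ ω, ‖φ ω‖ * Real.exp (-(α * t / 2) * ‖u - ω‖ ^ 2) = (α / Real.pi)⁻¹ * β u :=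
    fun u => by rw [hβ, inv_mul_cancel_left₀ hαπ.ne']
  obtain ⟨M, hM⟩ := h0.exists_norm_le
  -- With `c = α / 4` the resulting rate `2 * c` is `α / 2`, that of the 1-Berezin transform.
  have hq : 0 < α / 4 := by positivity
  have hβint : ∀ z, Integrable fun u => β u * Real.exp (-(α / 4) * ‖z - u‖ ^ 2) := fun z =>
    (integrable_exp_neg_mul_norm_sub_sq hq z).bdd_mul h0.1.aestronglyMeasurable (ae_of_all _ hM)
  obtain ⟨κ, hκ, hle⟩ := exists_integral_mul_exp_le (h := fun ω => ‖φ ω‖)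
    (fun ω => norm_nonneg _) hφ.1.aestronglyMeasurable.norm
    (show 0 < α * t / 2 by positivity) hq (fun u => hφ.integrable_mul_exp (by positivity) u)
    (fun z => by
      simp only [hβ', mul_assoc]
      exact (hβint z).const_mul _)
  have hb : ∀ z, berezin α 1 (fun ω => ‖φ ω‖) z ≤
      κ⁻¹ * ∫ u, β u * Real.exp (-(α / 4) * ‖z - u‖ ^ 2) := by
    intro z
    have h1 := hle z
    simp only [hβ', mul_assoc] at h1
    rw [integral_const_mul, le_inv_mul_iff₀ hαπ] at h1
    rw [le_inv_mul_iff₀ hκ, berezin]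
    have h2 : -(α * 1 / 2) = -(2 * (α / 4)) := by ring
    rw [h2]
    calc _ = _ := by ring
      _ ≤ _ := h1
  have hnn : ∀ z, 0 ≤ berezin α 1 (fun ω => ‖φ ω‖) z := fun z =>
    mul_nonneg hαπ.le (integral_nonneg fun ω => by positivity)
  constructor
  · refine ⟨κ⁻¹ * (M * ∫ u : ℂ, Real.exp (-(α / 4) * ‖u‖ ^ 2)), fun z => (hb z).trans ?_⟩
    gcongr
    rw [← integral_sub_left_eq_self (fun u : ℂ => Real.exp (-(α / 4) * ‖u‖ ^ 2)) volume z,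
      ← integral_const_mul]
    refine integral_mono (hβint z) ((integrable_exp_neg_mul_norm_sub_sq hq z).const_mul M)
      fun u => ?_
    have := (Real.le_norm_self _).trans (hM u)
    dsimp only
    gcongr
  · refine squeeze_zero hnn hb ?_
    simpa using (h0.tendsto_integral_mul_exp hq).const_mul κ⁻¹

/-! ### Compact sets in `F^∞_α` -/

lemma norm_le_of_weighted_le {α : ℝ} (hα : 0 < α) {f : ℂ → ℂ} {M R : ℝ} {z : ℂ}
    (h : weighted α f z ≤ M) (hz : ‖z‖ ≤ R) : ‖f z‖ ≤ M * Real.exp (α / 2 * R ^ 2) := by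
  have hM : 0 ≤ M := (weighted_nonneg α f z).trans h
  have h1 : ‖f z‖ = weighted α f z * Real.exp (α / 2 * ‖z‖ ^ 2) := by
    rw [weighted, mul_assoc, ← Real.exp_add]
    simp
  rw [h1]
  gcongr

/-- Entire functions with a common bound on `|f(z)| e^{-α|z|²/2}` are equicontinuous. -/
lemma equicontinuous_of_weighted_le {α : ℝ} (hα : 0 < α) {ι : Type*} {F : ι → ℂ → ℂ} {M : ℝ}
    (hF : ∀ i, Differentiable ℂ (F i)) (hM : ∀ i z, weighted α (F i) z ≤ M) :
    Equicontinuous F := by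
  intro z
  -- `Q` bounds the whole family on the unit disc about `z`, where values differ from the central
  -- one by at most `2 * Q`; the Schwarz lemma then gives a common Lipschitz bound at `z`.
  set Q := M * Real.exp (α / 2 * (‖z‖ + 1) ^ 2)
  refine Metric.equicontinuousAt_of_continuity_modulus (fun w => (2 * Q) / 1 * dist w z) ?_ F ?_
  · have : Continuous fun w : ℂ => (2 * Q) / 1 * dist w z := by fun_prop
    simpa using this.tendsto z
  · filter_upwards [Metric.ball_mem_nhds z one_pos] with w hw i
    have hb : ∀ u ∈ Metric.ball z 1, ‖F i u‖ ≤ Q := fun u hu => by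
      refine norm_le_of_weighted_le hα (hM i u) ?_
      have h1 := norm_le_insert' u z
      have h2 : ‖u - z‖ < 1 := by simpa [dist_eq_norm] using hu
      linarith
    rw [dist_comm]
    refine Complex.dist_le_div_mul_dist_of_mapsTo_ball (hF i).differentiableOn (fun u hu => ?_) hw
    rw [Metric.mem_closedBall, dist_eq_norm]
    have h1 := norm_sub_le (F i u) (F i z)
    have h2 := hb u hu
    have h3 := hb z (Metric.mem_ball_self one_pos)
    linarith

/-- Ascoli: on an equicontinuous family the topologies of pointwise and of compact convergence
agree. -/
lemma tendstoUniformlyOn_of_equicontinuous {ι : Type*} {F : ι → ℂ → ℂ} (hF : Equicontinuous F)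
    {p : Filter ι} {g : ℂ → ℂ} (hg : ∀ z, Tendsto (fun i => F i z) p (𝓝 (g z)))
    {K : Set ℂ} (hK : IsCompact K) : TendstoUniformlyOn F g p K := by
  have h := (EquicontinuousOn.tendsto_uniformOnFun_iff_pi (𝔖 := {K : Set ℂ | IsCompact K})
    (F := F) (fun _ h => h)
    (Set.eq_univ_iff_forall.mpr fun x => Set.mem_sUnion_of_mem (Set.mem_singleton x)
      isCompact_singleton) (fun K _ => hF.equicontinuousOn K) p g).2 (tendsto_pi_nhds.2 hg)
  exact UniformOnFun.tendsto_iff_tendstoUniformlyOn.1 h K hK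

/-- A family of entire functions dominated in weighted modulus by a bounded function vanishing at
infinity is compact in `F^∞_α`. -/
lemma isCompact_setOf_weighted_le {α : ℝ} (hα : 0 < α) {b : ℂ → ℝ} {M : ℝ} (hM : ∀ z, b z ≤ M)
    (hb : Tendsto b (cocompact ℂ) (𝓝 0)) :
    IsCompact {f : FInfty α | ∀ z, weighted α f z ≤ b z} := by
  set K := {f : FInfty α | ∀ z, weighted α f z ≤ b z}
  -- Along an ultrafilter, the bounded values at each point converge at once, without extracting
  -- subsequences.
  rw [isCompact_iff_compactSpace, ← isCompact_univ_iff, isCompact_iff_ultrafilter_le_nhds]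
  intro U _
  set F : K → ℂ → ℂ := fun f => f.1
  have hdiff : ∀ f, Differentiable ℂ (F f) := fun f => f.1.2.1
  have hle : ∀ f z, weighted α (F f) z ≤ b z := fun f z => f.2 z
  have heq : Equicontinuous F :=
    equicontinuous_of_weighted_le hα hdiff fun f z => (hle f z).trans (hM z)
  have hlim : ∀ z, ∃ a, Tendsto (fun f => F f z) U (𝓝 a) := by
    intro z
    have hc := isCompact_closedBall (0 : ℂ) (b z * Real.exp (α / 2 * ‖z‖ ^ 2))
    obtain ⟨a, -, ha⟩ := isCompact_iff_ultrafilter_le_nhds.1 hc (U.map fun f => F f z) (by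
      rw [Ultrafilter.coe_map, le_principal_iff, mem_map]
      refine univ_mem' fun f => ?_
      rw [Set.mem_preimage, mem_closedBall_zero_iff]
      exact norm_le_of_weighted_le hα (hle f z) le_rfl)
    exact ⟨a, ha⟩
  choose g hg using hlim
  have hunif : ∀ {S : Set ℂ}, IsCompact S → TendstoUniformlyOn F g U S :=
    fun hS => tendstoUniformlyOn_of_equicontinuous heq hg hS
  have hgd : Differentiable ℂ g := by
    rw [← differentiableOn_univ]
    refine TendstoLocallyUniformlyOn.differentiableOn (F := F) (φ := (U : Filter K)) ?_
      (Eventually.of_forall fun f => (hdiff f).differentiableOn) isOpen_univ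
    rw [tendstoLocallyUniformlyOn_iff_forall_isCompact isOpen_univ]
    exact fun S _ hS => hunif hS
  have hgb : ∀ z, weighted α g z ≤ b z := fun z =>
    le_of_tendsto ((hg z).norm.mul_const _) (Eventually.of_forall fun f => hle f z)
  set G : FInfty α := ⟨g, hgd, M, by
    rintro _ ⟨z, rfl⟩
    exact (hgb z).trans (hM z)⟩
  refine ⟨⟨G, hgb⟩, Set.mem_univ _, ?_⟩
  suffices h : Tendsto (fun f : K => f.1) U (𝓝 G) by
    have := (tendsto_subtype_rng (f := fun f : K => f) (x := ⟨G, hgb⟩)).2 h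
    exact this
  rw [Metric.tendsto_nhds]
  intro ε hε
  -- Off `S` both `F f` and the limit have weighted modulus below `ε / 4`; on `S` uniform
  -- convergence decides. The target is `ε / 2`, as a supremum keeps only non-strict bounds.
  obtain ⟨S, hS, hSb⟩ := mem_cocompact.1 (hb.eventually (gt_mem_nhds (show 0 < ε / 4 by positivity)))
  filter_upwards [Metric.tendstoUniformlyOn_iff.1 (hunif hS) (ε / 2) (by positivity)] with f hf
  rw [dist_eq_norm]
  refine lt_of_le_of_lt ?_ (half_lt_self hε)
  rw [FInfty.norm_def]
  refine ciSup_le fun z => ?_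
  change ‖F f z - g z‖ * Real.exp (-(α / 2) * ‖z‖ ^ 2) ≤ ε / 2
  have he : Real.exp (-(α / 2) * ‖z‖ ^ 2) ≤ 1 := by
    rw [Real.exp_le_one_iff]
    have : 0 ≤ α / 2 * ‖z‖ ^ 2 := by positivity
    linarith
  by_cases hz : z ∈ S
  · have h1 : ‖F f z - g z‖ ≤ ε / 2 := by
      rw [← dist_eq_norm, dist_comm]
      exact (hf z hz).le
    calc _ ≤ ‖F f z - g z‖ * 1 := by gcongr
      _ ≤ _ := by linarith
  · have h1 : b z < ε / 4 := hSb hz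
    have h2 := hle f z
    have h3 := hgb z
    simp only [weighted] at h2 h3
    calc _ ≤ (‖F f z‖ + ‖g z‖) * Real.exp (-(α / 2) * ‖z‖ ^ 2) := by
          gcongr
          exact norm_sub_le _ _
      _ ≤ ε / 2 := by rw [add_mul]; linarith

/-! ### The Toeplitz operator -/

lemma integrable_gaussian_iff {α : ℝ} (hα : 0 < α) {F : ℂ → ℂ} :
    Integrable F (gaussian α) ↔
      Integrable fun ω => (α / Real.pi * Real.exp (-α * ‖ω‖ ^ 2)) • F ω := by
  rw [gaussian, integrable_withDensity_iff_integrable_smul' (by fun_prop) (by simp)]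
  refine integrable_congr (ae_of_all _ fun ω => ?_)
  simp only
  rw [ENNReal.toReal_ofReal (by positivity)]

lemma integral_gaussian {α : ℝ} (hα : 0 < α) (F : ℂ → ℂ) :
    ∫ ω, F ω ∂(gaussian α) = ∫ ω, (α / Real.pi * Real.exp (-α * ‖ω‖ ^ 2)) • F ω := by
  rw [gaussian, integral_withDensity_eq_integral_toReal_smul (by fun_prop) (by simp)]
  refine integral_congr_ae (ae_of_all _ fun ω => ?_)
  simp only
  rw [ENNReal.toReal_ofReal (by positivity)]

lemma continuous_gaussianDensity (α : ℝ) :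
    Continuous fun ω : ℂ => α / Real.pi * Real.exp (-α * ‖ω‖ ^ 2) := by
  fun_prop

lemma gaussian_absolutelyContinuous (α : ℝ) : gaussian α ≪ volume :=
  withDensity_absolutelyContinuous _ _

/-- This form shows that the conjugated kernel is holomorphic in `z`. -/
lemma conj_kernel (α : ℝ) (z ω : ℂ) :
    (starRingEnd ℂ) (kernel α z ω) = Complex.exp (α * (starRingEnd ℂ) ω * z) := by
  rw [kernel, ← Complex.exp_conj]
  congr 1
  simp only [map_mul, Complex.conj_conj, Complex.conj_ofReal]
  ring

lemma norm_kernel (α : ℝ) (z ω : ℂ) :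
    ‖kernel α z ω‖ = Real.exp (α / 2 * (‖z‖ ^ 2 + ‖ω‖ ^ 2 - ‖z - ω‖ ^ 2)) := by
  rw [kernel, Complex.norm_exp]
  congr 1
  rw [Complex.sq_norm, Complex.sq_norm, Complex.sq_norm, Complex.normSq_sub]
  simp [Complex.normSq_apply]
  ring

/-- The weighted modulus of the Toeplitz integrand. -/
lemma norm_toeplitzIntegrand {α : ℝ} (hα : 0 < α) (φ f : ℂ → ℂ) (z ω : ℂ) :
    ‖(α / Real.pi * Real.exp (-α * ‖ω‖ ^ 2)) • toeplitzIntegrand α φ f z ω‖ *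
        Real.exp (-(α / 2) * ‖z‖ ^ 2) =
      α / Real.pi * (weighted α f ω * (‖φ ω‖ * Real.exp (-(α * 1 / 2) * ‖z - ω‖ ^ 2))) := by
  -- The kernel cancels the weight at `z` and half of the Gaussian in `ω`; the other half is the
  -- weight of `f`.
  have h : Real.exp (-α * ‖ω‖ ^ 2) * Real.exp (α / 2 * (‖z‖ ^ 2 + ‖ω‖ ^ 2 - ‖z - ω‖ ^ 2)) *
      Real.exp (-(α / 2) * ‖z‖ ^ 2) =
      Real.exp (-(α / 2) * ‖ω‖ ^ 2) * Real.exp (-(α * 1 / 2) * ‖z - ω‖ ^ 2) := by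
    rw [← Real.exp_add, ← Real.exp_add, ← Real.exp_add]
    congr 1
    ring
  rw [norm_smul, Real.norm_of_nonneg (by positivity), toeplitzIntegrand, norm_mul, norm_mul,
    RCLike.norm_conj, norm_kernel, weighted]
  linear_combination (α / Real.pi * ‖φ ω‖ * ‖f ω‖) * h

lemma aestronglyMeasurable_toeplitzIntegrand {α : ℝ} {φ : ℂ → ℂ} (hφ : MemBMO φ) (f : FInfty α)
    (z : ℂ) : AEStronglyMeasurable (toeplitzIntegrand α φ f z) volume := by
  have hf : Continuous f.1 := f.2.1.continuous
  refine (hφ.1.aestronglyMeasurable.mul hf.aestronglyMeasurable).mul ?_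
  refine Continuous.aestronglyMeasurable ?_
  unfold kernel
  exact Complex.continuous_conj.comp (by fun_prop)

lemma integrable_toeplitzIntegrand {α : ℝ} (hα : 0 < α) {φ : ℂ → ℂ} (hφ : MemBMO φ)
    (f : FInfty α) (z : ℂ) : Integrable (toeplitzIntegrand α φ f z) (gaussian α) := by
  rw [integrable_gaussian_iff hα]
  have h := ((hφ.integrable_mul_exp (show 0 < α * 1 / 2 by positivity) z).const_mul
    (α / Real.pi * ‖f‖)).mul_const (Real.exp (-(α / 2) * ‖z‖ ^ 2))⁻¹
  refine h.mono' ((continuous_gaussianDensity α).aestronglyMeasurable.smul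
    (aestronglyMeasurable_toeplitzIntegrand hφ f z)) (ae_of_all _ fun ω => ?_)
  rw [le_mul_inv_iff₀ (Real.exp_pos _), norm_toeplitzIntegrand hα, mul_assoc]
  gcongr
  exact f.weighted_le_norm ω

/-- The function `T_φ f`. -/
def toeplitz (α : ℝ) (φ : ℂ → ℂ) (f : ℂ → ℂ) (z : ℂ) : ℂ :=
  ∫ ω, toeplitzIntegrand α φ f z ω ∂(gaussian α)

/-- The key estimate: the supremum of the right side gives boundedness, its decay in `z`
compactness. -/
lemma weighted_toeplitz_le {α : ℝ} (hα : 0 < α) {φ : ℂ → ℂ} (hφ : MemBMO φ)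
    (f : FInfty α) (z : ℂ) :
    weighted α (toeplitz α φ f) z ≤ ‖f‖ * berezin α 1 (fun ω => ‖φ ω‖) z := by
  have hi := hφ.integrable_mul_exp (show 0 < α * 1 / 2 by positivity) z
  have hi' := (integrable_gaussian_iff hα).1 (integrable_toeplitzIntegrand hα hφ f z)
  calc weighted α (toeplitz α φ f) z
      ≤ (∫ ω, ‖(α / Real.pi * Real.exp (-α * ‖ω‖ ^ 2)) • toeplitzIntegrand α φ f z ω‖) *
        Real.exp (-(α / 2) * ‖z‖ ^ 2) := by
        rw [weighted, toeplitz, integral_gaussian hα]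
        gcongr
        exact norm_integral_le_integral_norm _
    _ = ∫ ω, α / Real.pi *
          (weighted α f ω * (‖φ ω‖ * Real.exp (-(α * 1 / 2) * ‖z - ω‖ ^ 2))) := by
        rw [← integral_mul_const]
        simp only [norm_toeplitzIntegrand hα]
    _ ≤ ∫ ω, α / Real.pi * (‖f‖ * (‖φ ω‖ * Real.exp (-(α * 1 / 2) * ‖z - ω‖ ^ 2))) := by
        refine integral_mono ?_ ((hi.const_mul _).const_mul _) fun ω => ?_
        · refine (hi'.norm.mul_const (Real.exp (-(α / 2) * ‖z‖ ^ 2))).congr (ae_of_all _ fun ω => ?_)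
          exact norm_toeplitzIntegrand hα φ f z ω
        · dsimp only
          gcongr
          exact f.weighted_le_norm ω
    _ = _ := by
        rw [integral_const_mul, integral_const_mul, berezin]
        ring

lemma differentiable_toeplitz {α : ℝ} (hα : 0 < α) {φ : ℂ → ℂ} (hφ : MemBMO φ)
    (f : FInfty α) : Differentiable ℂ (toeplitz α φ f) := by
  intro z
  -- For `w` in the unit disc about `z` the kernel grows at rate at most `α * (‖z‖ + 1)`; the extra
  -- 1 pays for the factor `‖ω‖ ≤ e^{‖ω‖}` from differentiation.
  set k := α * (‖z‖ + 1) + 1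
  set bound : ℂ → ℝ := fun ω => ‖φ ω‖ * (α * ‖f‖ * Real.exp (α / 2 * ‖ω‖ ^ 2 + k * ‖ω‖))
  have hf : Continuous f.1 := f.2.1.continuous
  have hbm : AEStronglyMeasurable bound volume :=
    hφ.1.aestronglyMeasurable.norm.mul (Continuous.aestronglyMeasurable (by fun_prop))
  have hbound : Integrable bound (gaussian α) := by
    have h : Integrable (fun ω => (bound ω : ℂ)) (gaussian α) := by
      rw [integrable_gaussian_iff hα]
      have h := (hφ.integrable_mul_exp (show 0 < α / 2 / 2 by positivity) 0).const_mul
        (α / Real.pi * (α * ‖f‖) * Real.exp (k ^ 2 / (2 * (α / 2))))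
      refine h.mono' ((continuous_gaussianDensity α).aestronglyMeasurable.smul
        (Complex.continuous_ofReal.comp_aestronglyMeasurable hbm)) (ae_of_all _ fun ω => ?_)
      rw [norm_smul, Complex.norm_real, Real.norm_of_nonneg (by positivity),
        Real.norm_of_nonneg (by positivity), zero_sub, norm_neg]
      have h1 : Real.exp (-α * ‖ω‖ ^ 2) * Real.exp (α / 2 * ‖ω‖ ^ 2 + k * ‖ω‖) ≤
          Real.exp (k ^ 2 / (2 * (α / 2))) * Real.exp (-(α / 2 / 2) * ‖ω‖ ^ 2) := by
        rw [← Real.exp_add, ← Real.exp_add, Real.exp_le_exp]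
        have := linear_sub_sq_le (half_pos hα) k ‖ω‖
        linarith
      calc _ = α / Real.pi * (α * ‖f‖) * ‖φ ω‖ *
            (Real.exp (-α * ‖ω‖ ^ 2) * Real.exp (α / 2 * ‖ω‖ ^ 2 + k * ‖ω‖)) := by
            simp only [bound]; ring
        _ ≤ α / Real.pi * (α * ‖f‖) * ‖φ ω‖ *
            (Real.exp (k ^ 2 / (2 * (α / 2))) * Real.exp (-(α / 2 / 2) * ‖ω‖ ^ 2)) := by gcongr
        _ = _ := by ring
    exact h.re
  refine (hasDerivAt_integral_of_dominated_loc_of_deriv_le (Metric.ball_mem_nhds z one_pos)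
    (F := fun z ω => toeplitzIntegrand α φ f z ω)
    (F' := fun z ω => φ ω * f ω * (Complex.exp (α * (starRingEnd ℂ) ω * z) *
      (α * (starRingEnd ℂ) ω)))
    (Eventually.of_forall fun w => (aestronglyMeasurable_toeplitzIntegrand hφ f w).mono_ac
      (gaussian_absolutelyContinuous α))
    (integrable_toeplitzIntegrand hα hφ f z) ?_ (ae_of_all _ fun ω w hw => ?_) hbound
    (ae_of_all _ fun ω w _ => ?_)).2.differentiableAt
  · refine AEStronglyMeasurable.mono_ac (gaussian_absolutelyContinuous α) ?_
    refine (hφ.1.aestronglyMeasurable.mul hf.aestronglyMeasurable).mul ?_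
    have := Complex.continuous_conj
    exact Continuous.aestronglyMeasurable (by fun_prop)
  · have h1 : ‖f ω‖ ≤ ‖f‖ * Real.exp (α / 2 * ‖ω‖ ^ 2) :=
      norm_le_of_weighted_le hα (f.weighted_le_norm ω) le_rfl
    have hw' : ‖w‖ ≤ ‖z‖ + 1 := by
      have h2 := norm_le_insert' w z
      have h3 : ‖w - z‖ < 1 := by simpa [dist_eq_norm] using hw
      linarith
    have h2 : ‖Complex.exp (α * (starRingEnd ℂ) ω * w)‖ ≤ Real.exp (α * (‖z‖ + 1) * ‖ω‖) := by
      refine (Complex.norm_exp_le_exp_norm _).trans (Real.exp_le_exp.2 ?_)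
      rw [norm_mul, norm_mul, RCLike.norm_conj, Complex.norm_real, Real.norm_of_nonneg hα.le]
      calc α * ‖ω‖ * ‖w‖ ≤ α * ‖ω‖ * (‖z‖ + 1) := by gcongr
        _ = _ := by ring
    have h3 : ‖ω‖ ≤ Real.exp ‖ω‖ := by linarith [Real.add_one_le_exp ‖ω‖]
    rw [norm_mul, norm_mul, norm_mul, norm_mul, RCLike.norm_conj, Complex.norm_real,
      Real.norm_of_nonneg hα.le]
    calc ‖φ ω‖ * ‖f ω‖ * (‖Complex.exp (α * (starRingEnd ℂ) ω * w)‖ * (α * ‖ω‖))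
        ≤ ‖φ ω‖ * (‖f‖ * Real.exp (α / 2 * ‖ω‖ ^ 2)) *
          (Real.exp (α * (‖z‖ + 1) * ‖ω‖) * (α * Real.exp ‖ω‖)) := by gcongr
      _ = bound ω := by
          have : α / 2 * ‖ω‖ ^ 2 + k * ‖ω‖ =
              α / 2 * ‖ω‖ ^ 2 + α * (‖z‖ + 1) * ‖ω‖ + ‖ω‖ := by simp only [k]; ring
          simp only [bound]
          rw [this, Real.exp_add, Real.exp_add]
          ring
  · simp only [toeplitzIntegrand, conj_kernel]
    have h1 : HasDerivAt (fun x : ℂ => α * (starRingEnd ℂ) ω * x) (α * (starRingEnd ℂ) ω) w := by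
      simpa using (hasDerivAt_id w).const_mul (α * (starRingEnd ℂ) ω)
    exact h1.cexp.const_mul _

/-- The Toeplitz operator with `BMO` symbol, when the `1`-Berezin transform of `|φ|` is bounded. -/
def toeplitzCLM {α : ℝ} (hα : 0 < α) {φ : ℂ → ℂ} (hφ : MemBMO φ) {M : ℝ}
    (hM : ∀ z, berezin α 1 (fun ω => ‖φ ω‖) z ≤ M) : FInfty α →L[ℂ] FInfty α :=
  LinearMap.mkContinuous
    { toFun := fun f => ⟨toeplitz α φ f, differentiable_toeplitz hα hφ f, ‖f‖ * M, by
        rintro _ ⟨z, rfl⟩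
        exact (weighted_toeplitz_le hα hφ f z).trans
          (mul_le_mul_of_nonneg_left (hM z) (norm_nonneg f))⟩
      map_add' := fun f g => Subtype.ext <| funext fun z => by
        change toeplitz α φ (f.1 + g.1) z = toeplitz α φ f.1 z + toeplitz α φ g.1 z
        rw [toeplitz, toeplitz, toeplitz, ← integral_add (integrable_toeplitzIntegrand hα hφ f z)
          (integrable_toeplitzIntegrand hα hφ g z)]
        congr 1
        ext ω
        simp only [toeplitzIntegrand, Pi.add_apply]
        ring
      map_smul' := fun c f => Subtype.ext <| funext fun z => by
        change toeplitz α φ (c • f.1) z = c • toeplitz α φ f.1 z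
        rw [toeplitz, toeplitz, ← integral_smul]
        congr 1
        ext ω
        simp only [toeplitzIntegrand, Pi.smul_apply, smul_eq_mul]
        ring }
    M fun f => by
      rw [FInfty.norm_def]
      refine ciSup_le fun z => (weighted_toeplitz_le hα hφ f z).trans ?_
      rw [mul_comm]
      exact mul_le_mul_of_nonneg_right (hM z) (norm_nonneg f)

end Fock

end

theorem theorem4p7 (α : ℝ) (hα : 0 < α) (t : ℝ) (ht : 0 < t) (φ : ℂ → ℂ)
    (hφ : Fock.MemBMO φ)
    (h0 : Fock.MemC0 (Fock.berezin α t fun ω => ‖φ ω‖)) :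
    ∃ T : Fock.FInfty α →L[ℂ] Fock.FInfty α,
      Fock.IsToeplitz α φ T ∧ IsCompactOperator T := by
  obtain ⟨⟨M, hM⟩, hlim⟩ := hφ.berezin_one_of_memC0 hα ht h0
  refine ⟨Fock.toeplitzCLM hα hφ hM,
    fun f z => ⟨Fock.integrable_toeplitzIntegrand hα hφ f z, rfl⟩, _,
    Fock.isCompact_setOf_weighted_le hα hM hlim, ?_⟩
  -- It suffices that the unit ball, a neighbourhood of 0, is mapped into the compact set.
  filter_upwards [Metric.ball_mem_nhds (0 : Fock.FInfty α) one_pos] with f hf z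
  refine (Fock.weighted_toeplitz_le hα hφ f z).trans ?_
  have hb : 0 ≤ Fock.berezin α 1 (fun ω => ‖φ ω‖) z :=
    mul_nonneg (by positivity) (integral_nonneg fun ω => by positivity)
  exact mul_le_of_le_one_left hb (mem_ball_zero_iff.1 hf).le
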